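/- Theorem 3.4. Let $(W,S)$ be a Coxeter system ($S$ possibly infinite) with length function $\ell$ and Coxeter matrix $m$. Let $W^M$ be its Coxeter monoid, i.e. the monoid with generators $S$ and relations $s^2=s$ and, whenever $m(s,t)<\infty$, the braid relation $(st)^{m(s,t)/2}=(ts)^{m(s,t)/2}$ for $m(s,t)$ even and $t(st)^{(m(s,t)-1)/2}=s(ts)^{(m(s,t)-1)/2}$ for $m(s,t)$ odd. Let $\mathbb{Z}W$ be the free $\mathbb{Z}$-module on the set $W$. For $J\subseteq S$ let $W_J$ be the subgroup generated by $J$, let $W^J=\{w\in W:\ell(ws)>\ell(w)\ \forall s\in J\}$, and let $P^J\in\mathrm{End}(\mathbb{Z}W)$ be the linear extension of the map $w=w^Jw_J\mapsto w^J$, where $w^J\in W^J$ and $w_J\in W_J$. Let $\tilde M(W,S)$ be the subalgebra with identity of $\mathrm{End}(\mathbb{Z}W)$ generated by the $P^{\{s\}}$, $s\in S$. For $u\in W$ with reduced word $s_1\cdots s_k$ put $P^u:=P^{\{s_1\}}\cdots P^{\{s_k\}}$. Then: 1. $P^u$ does not depend on the choice of the reduced word of $u$. 2. Sending $u=s_1\cdots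 s_k$ (reduced) to the product $s_1\cdots s_k$ in $W^M$ is a well-defined bijection $W\to W^M$, by which $W$ and $W^M$ are identified as sets. 3. The map $u\mapsto P^u$ extends to an isomorphism of $\mathbb{Z}$-algebras $\mathbb{Z}[W^M]\simeq\tilde M(W,S)$. 4. Consequently the $0$-Hecke algebra of $(W,S)$, i.e. the unital associative $\mathbb{Z}$-algebra with generators $T_s$ ($s\in S$), relations $T_s^2=-T_s$ and the braid relations above with $T_s,T_t$ in place of $s,t$, is represented faithfully on $\mathbb{Z}W$. It has a $\mathbb{Z}$-basis $(T_w)_{w\in W}$, extending the generators $T_s$, with $T_e=1$, $T_wT_s=T_{ws}$ if $\ell(ws)>\ell(w)$ and $T_wT_s=-T_w$ if $\ell(ws)<\ell(w)$. The assignment $T_s\mapsto -P^{\{s\}}$ defines an injective homomorphism of $\mathbb{Z}$-algebras into $\mathrm{End}(\mathbb{Z}W)$ with image $\tilde M(W,S)$, which sends $T_w$ to $(-1)^{\ell(w)}P^w$ for all $w\in W$. -/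

import Mathlib

noncomputable section

namespace CoxeterMatrix

variable {B : Type*} (M : CoxeterMatrix B)

/-- The defining relations of the Coxeter monoid: `s² = s`, and for `m(s,t)` finite the braid
relation between the alternating words of length `m(s,t)`, that is `(st)^(m/2) = (ts)^(m/2)` for `m`
even and `t(st)^((m-1)/2) = s(ts)^((m-1)/2)` for `m` odd. In Mathlib `m(s,t) = ∞` is encoded by
`M s t = 0`, and then there is no braid relation. -/
inductive MonoidRel : FreeMonoid B → FreeMonoid B → Prop
  | idem (s : B) : MonoidRel (FreeMonoid.of s * FreeMonoid.of s) (FreeMonoid.of s)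
  | even (s t : B) (h0 : M s t ≠ 0) (h : Even (M s t)) :
      MonoidRel ((FreeMonoid.of s * FreeMonoid.of t) ^ (M s t / 2))
        ((FreeMonoid.of t * FreeMonoid.of s) ^ (M s t / 2))
  | odd (s t : B) (h : Odd (M s t)) :
      MonoidRel (FreeMonoid.of t * (FreeMonoid.of s * FreeMonoid.of t) ^ ((M s t - 1) / 2))
        (FreeMonoid.of s * (FreeMonoid.of t * FreeMonoid.of s) ^ ((M s t - 1) / 2))

/-- The Coxeter monoid `W^M`, by generators and relations. -/
abbrev CoxeterMonoid : Type _ := PresentedMonoid M.MonoidRel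

/-- The generator of the Coxeter monoid attached to `s`. -/
def monoidGen (s : B) : M.CoxeterMonoid := PresentedMonoid.of M.MonoidRel s

/-- The defining relations of the Hecke algebra over `R` with parameter `q`:
`T_s² = (q - 1) T_s + q`, and the braid relations. -/
inductive HeckeRel {R : Type*} [CommRing R] (q : R) : FreeAlgebra R B → FreeAlgebra R B → Prop
  | quadratic (s : B) :
      HeckeRel q (FreeAlgebra.ι R s * FreeAlgebra.ι R s)
        (algebraMap R (FreeAlgebra R B) (q - 1) * FreeAlgebra.ι R s +
          algebraMap R (FreeAlgebra R B) q)
  | even (s t : B) (h0 : M s t ≠ 0) (h : Even (M s t)) :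
      HeckeRel q ((FreeAlgebra.ι R s * FreeAlgebra.ι R t) ^ (M s t / 2))
        ((FreeAlgebra.ι R t * FreeAlgebra.ι R s) ^ (M s t / 2))
  | odd (s t : B) (h : Odd (M s t)) :
      HeckeRel q
        (FreeAlgebra.ι R t * (FreeAlgebra.ι R s * FreeAlgebra.ι R t) ^ ((M s t - 1) / 2))
        (FreeAlgebra.ι R s * (FreeAlgebra.ι R t * FreeAlgebra.ι R s) ^ ((M s t - 1) / 2))

/-- The Hecke algebra over `R` with parameter `q`, by generators `T_s` and relations. -/
abbrev HeckeAlgebra {R : Type*} [CommRing R] (q : R) : Type _ := RingQuot (M.HeckeRel q)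

/-- The `0`-Hecke algebra over `ℤ`. -/
abbrev ZeroHeckeAlgebra : Type _ := M.HeckeAlgebra (0 : ℤ)

/-- The generator `T_s` of the `0`-Hecke algebra. -/
def zeroHeckeGen (s : B) : M.ZeroHeckeAlgebra :=
  RingQuot.mkAlgHom ℤ (M.HeckeRel (0 : ℤ)) (FreeAlgebra.ι ℤ s)

end CoxeterMatrix

namespace CoxeterSystem

variable {B W : Type*} [Group W] {M : CoxeterMatrix B} (cs : CoxeterSystem M W)

/-- The parabolic subgroup `W_J`. -/
def parabolic (J : Set B) : Subgroup W := Subgroup.closure (cs.simple '' J)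

/-- The parabolic quotient `W^J = {w | ℓ(ws) > ℓ(w) for all s ∈ J}`. -/
def minReps (J : Set B) : Set W := {w | ∀ s ∈ J, cs.length w < cs.length (w * cs.simple s)}

theorem exists_parabolic_factorization (J : Set B) (w : W) :
    ∃ x ∈ cs.minReps J, ∃ y ∈ cs.parabolic J, w = x * y := by
  have hne : ∃ n, ∃ y ∈ cs.parabolic J, cs.length (w * y) = n := ⟨_, 1, one_mem _, rfl⟩
  classical
  obtain ⟨y, hy, hn⟩ := Nat.find_spec hne
  refine ⟨w * y, fun s hs => ?_, y⁻¹, inv_mem hy, by group⟩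
  have hs' : cs.simple s ∈ cs.parabolic J := Subgroup.subset_closure ⟨s, hs, rfl⟩
  have h1 := Nat.find_min' hne ⟨y * cs.simple s, mul_mem hy hs', rfl⟩
  rw [← mul_assoc] at h1
  have h2 := cs.length_mul_simple_ne (w * y) s
  omega

/-- The projection `P^J : W → W`, `w = w^J w_J ↦ w^J`, where `w^J ∈ W^J` and `w_J ∈ W_J`
(this factorization of `w` is unique). -/
def proj (J : Set B) (w : W) : W := (cs.exists_parabolic_factorization J w).choose

/-- The endomorphism `P^J` of the free `ℤ`-module on `W`. -/
def projEnd (J : Set B) : Module.End ℤ (W →₀ ℤ) := Finsupp.lmapDomain ℤ ℤ (cs.proj J)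

/-- The subalgebra (with identity) of `End(ℤW)` generated by the `P^{s}`, `s ∈ S`. -/
def projAlgebra : Subalgebra ℤ (Module.End ℤ (W →₀ ℤ)) :=
  Algebra.adjoin ℤ (Set.range fun s : B => cs.projEnd {s})

/-- A reduced word of `u`. -/
def reducedWord (u : W) : List B := (cs.exists_isReduced u).choose

/-- The endomorphism `P^u = P^{s₁} ⋯ P^{sₖ}`, where `s₁ ⋯ sₖ` is a reduced word of `u`. -/
def projElem (u : W) : Module.End ℤ (W →₀ ℤ) :=
  ((cs.reducedWord u).map fun s => cs.projEnd {s}).prod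

/-- The identification of `W` with the Coxeter monoid as sets: `u` goes to the product in the
monoid of the letters of a reduced word of `u`. -/
def toMonoid (u : W) : M.CoxeterMonoid := ((cs.reducedWord u).map M.monoidGen).prod

end CoxeterSystem

end

/-! On basis vectors `P^{s}` is the idempotent map `w ↦ min (w, w s)`, called `down s`. These maps
satisfy the braid relations: on a coset of the dihedral subgroup `⟨s, t⟩`, with `m(s,t)` finite,
both alternating words of length `m(s,t)` send everything to the shortest element of the coset
(`downWord_alternatingWord_comm`). So the `P^{s}` represent the Coxeter monoid and the `-P^{s}`
represent the `0`-Hecke algebra, and Matsumoto's theorem (`IsReduced.prod_map_eq`) makes products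
along reduced words well defined in all these targets.

Faithfulness is a triangularity argument. Each letter lowers length by at most one, so `P^u` sends
an element of length at least `ℓ(u)` to `1` only if that element is `u`. Evaluating a linear
relation at a longest `u` in its support and reading off the coefficient of `1` shows that the `P^u`
are independent (`linearIndependent_projElem`). Conversely, right multiplication by generators shows
that reduced products exhaust the monoid and span the Hecke algebra. The bijection, the isomorphism
and the basis follow.

The input on Coxeter groups is `exists_eq_mul_braidWord`: if `s` and `t` are right descents of `w`,
then `w` has a reduced word ending in the longest dihedral word. It needs the exchange condition,
from a parity action on `W × ℤ/2`, and the fact that `s t` has order exactly `m(s,t)`, from the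
geometric representation. -/

noncomputable section

/-! ### The geometric representation and the order of `s t` -/

namespace CoxeterMatrix

variable {B : Type*} (M : CoxeterMatrix B)

/-- The coroot of `i` in the geometric representation: the linear form sending the `j`-th simple
root to `-2 cos (π / m(i,j))`. -/
def geomCoroot (i : B) : Module.Dual ℝ (B →₀ ℝ) :=
  Finsupp.linearCombination ℝ fun j => -2 * Real.cos (Real.pi / M i j)

theorem geomCoroot_single (i j : B) :
    M.geomCoroot i (Finsupp.single j 1) = -2 * Real.cos (Real.pi / M i j) := by
  simp [geomCoroot]

theorem geomCoroot_self (i : B) : M.geomCoroot i (Finsupp.single i 1) = 2 := by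
  simp [geomCoroot_single]

/-- The simple reflections of the geometric representation. -/
def geomReflection (i : B) : (B →₀ ℝ) ≃ₗ[ℝ] (B →₀ ℝ) :=
  Module.reflection (M.geomCoroot_self i)

/-- The parameter in the Chebyshev formulas for powers of a product of two reflections: the product
acts on the plane of the two roots with trace `2 cos (2π/m)`. -/
theorem geomCoroot_mul_geomCoroot (i j : B) :
    M.geomCoroot i (Finsupp.single j 1) * M.geomCoroot j (Finsupp.single i 1) - 2 =
      2 * Real.cos (2 * Real.pi / M i j) := by
  rw [geomCoroot_single, geomCoroot_single, M.symmetric j i, mul_div_assoc, Real.cos_two_mul]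
  ring

theorem sin_two_pi_div_ne_zero {m : ℕ} (hm : 3 ≤ m) : Real.sin (2 * Real.pi / m) ≠ 0 := by
  have hm' : (3 : ℝ) ≤ m := by exact_mod_cast hm
  refine (Real.sin_pos_of_pos_of_lt_pi (by positivity) ?_).ne'
  rw [div_lt_iff₀ (by linarith)]
  nlinarith [Real.pi_pos]

theorem geomReflection_mul_pow (i j : B) :
    (M.geomReflection i * M.geomReflection j) ^ M i j = 1 := by
  have htr := M.geomCoroot_mul_geomCoroot i j
  have hij := M.geomCoroot_single i j
  have hji := M.geomCoroot_single j i
  rw [M.symmetric j i] at hji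
  have key (z : B →₀ ℝ) := Module.reflection_mul_reflection_pow_apply (M.geomCoroot_self i)
    (M.geomCoroot_self j) (M i j) z _ htr.symm
  rw [← geomReflection, ← geomReflection] at key
  generalize hm : M i j = m at *
  -- For `m = 1, 2` the factor `sin (2π/m)`, by which one must divide below, vanishes; `m = 0`
  -- encodes `∞`.
  rcases Nat.lt_or_ge m 3 with h3 | h3
  · interval_cases m
    · simp
    · obtain rfl : i = j := by
        by_contra h
        exact M.off_diagonal i j h hm
      ext1 z
      rw [pow_one, LinearEquiv.mul_apply, geomReflection,
        Module.involutive_reflection (M.geomCoroot_self i) z, LinearEquiv.coe_one, id]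
    · ext1 z
      norm_num at hij hji
      rw [pow_two]
      simp only [LinearEquiv.mul_apply, geomReflection, Module.reflection_apply, map_sub,
        map_smul, hij, hji, geomCoroot_self, LinearEquiv.coe_one, id]
      module
  · ext1 z
    rw [key z]
    have hs := sin_two_pi_div_ne_zero h3
    have hS := Polynomial.Chebyshev.S_two_mul_real_cos (2 * Real.pi / m)
    have hm0 : (m : ℝ) ≠ 0 := by positivity
    set θ := 2 * Real.pi / m with hθ
    have hmθ : m * θ = 2 * Real.pi := by rw [hθ]; field_simp
    -- Both correction terms of the power formula contain the factor `S_{k-1}` if `m = 2k`, and `S_k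
    -- + S_{k-1}` if `m = 2k + 1`. Times `sin θ`, these are `sin kθ` and `sin (k+1)θ + sin kθ`,
    -- which vanish since `mθ = 2π`.
    rcases Nat.even_or_odd' m with ⟨k, hk | hk⟩
    · have h1 : (((m : ℤ) - 2) / 2) = k - 1 := by omega
      have h2 : (((m : ℤ) - 1) / 2) = k - 1 := by omega
      have h0 : (Polynomial.Chebyshev.S ℝ ((k : ℤ) - 1)).eval (2 * Real.cos θ) = 0 := by
        apply (mul_eq_zero.1 ((hS _).trans _)).resolve_right hs
        rw [← Real.sin_pi]
        congr 1
        push_cast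
        rw [hk] at hmθ
        push_cast at hmθ
        linarith
      rw [h1, h2, h0]
      simp
    · have h1 : (((m : ℤ) - 2) / 2) = k - 1 := by omega
      have h2 : (((m : ℤ) - 1) / 2) = k := by omega
      have h4 : (((m : ℤ) - 3) / 2) = k - 1 := by omega
      have h5 : ((m : ℤ) / 2) = k := by omega
      have h0 : (Polynomial.Chebyshev.S ℝ (k : ℤ)).eval (2 * Real.cos θ) +
          (Polynomial.Chebyshev.S ℝ ((k : ℤ) - 1)).eval (2 * Real.cos θ) = 0 := by
        apply (mul_eq_zero.1 (?_ : _ * Real.sin θ = 0)).resolve_right hs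
        rw [add_mul, hS, hS]
        have : ((k : ℤ) + 1 : ℝ) * θ = 2 * Real.pi - k * θ := by
          rw [hk] at hmθ
          push_cast at hmθ ⊢
          linarith
        rw [this, Real.sin_two_pi_sub]
        push_cast
        simp
      rw [h1, h2, h4, h5, h0]
      simp

/-- Apply the power to the root `α_i` and compare coefficients. For `m ≥ 3` this gives `S_{k-1} = 0`
and `S_k = 1` at `2 cos θ`, hence `cos kθ = 1`. For `m = ∞` the value `S_{k-1}(2) = k` must vanish.
-/
theorem dvd_of_geomReflection_mul_pow_eq_one (i j : B) (k : ℕ)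
    (h : (M.geomReflection i * M.geomReflection j) ^ k = 1) : M i j ∣ k := by
  by_cases hne : i = j
  · simp [hne]
  have htr := M.geomCoroot_mul_geomCoroot i j
  have hij := M.geomCoroot_single i j
  have hji := M.geomCoroot_single j i
  rw [M.symmetric j i] at hji
  have hsq := M.geomReflection_mul_pow i j
  have h1 : M i j ≠ 1 := M.off_diagonal i j hne
  have key := Module.reflection_mul_reflection_pow_apply_self (M.geomCoroot_self i)
    (M.geomCoroot_self j) k (t := 2 * Real.cos (2 * Real.pi / M i j)) htr.symm
  rw [← geomReflection, ← geomReflection, h, LinearEquiv.coe_one, id] at key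
  have keyi := DFunLike.congr_fun key i
  have keyj := DFunLike.congr_fun key j
  simp [hne, Ne.symm hne] at keyi keyj
  rw [hji] at keyj
  generalize hm : M i j = m at *
  rcases Nat.lt_or_ge m 3 with h3 | h3
  · interval_cases m
    · simp at keyj
      simp [keyj]
    · simp at h1
    -- For `m = 2` the roots are orthogonal and the `α_j` coefficient says nothing; an odd power
    -- would make the product itself trivial, yet it negates `α_i`.
    · rcases Nat.even_or_odd' k with ⟨l, rfl | rfl⟩
      · exact dvd_mul_right _ _
      · exfalso
        rw [pow_succ, pow_mul, hsq, one_pow, one_mul] at h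
        have := DFunLike.congr_fun (LinearEquiv.congr_fun h (Finsupp.single i 1)) i
        norm_num at hij hji
        simp [geomReflection, Module.reflection_apply, hji] at this
        norm_num at this
  · have hs := sin_two_pi_div_ne_zero h3
    have hS := Polynomial.Chebyshev.S_two_mul_real_cos (2 * Real.pi / m)
    have hm0 : (m : ℝ) ≠ 0 := by positivity
    have hc : Real.cos (Real.pi / m) ≠ 0 := by
      refine (Real.cos_pos_of_mem_Ioo ⟨?_, ?_⟩).ne'
      · have : 0 < Real.pi / m := by positivity
        linarith [Real.pi_pos]
      · have hm' : (3 : ℝ) ≤ m := by exact_mod_cast h3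
        rw [div_lt_div_iff_of_pos_left Real.pi_pos (by linarith) (by norm_num)]
        linarith
    set θ := 2 * Real.pi / m with hθ
    have h0 : (Polynomial.Chebyshev.S ℝ ((k : ℤ) - 1)).eval (2 * Real.cos θ) = 0 := by
      simpa [hc] using keyj
    rw [h0, add_zero] at keyi
    have e1 := hS k
    have e2 := hS (k - 1)
    rw [← keyi, one_mul] at e1
    rw [h0, zero_mul] at e2
    push_cast at e1 e2
    rw [sub_add_cancel] at e2
    rw [add_mul, one_mul, Real.sin_add, ← e2, zero_mul, zero_add] at e1
    have e3 : Real.cos (k * θ) = 1 := by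
      have : (Real.cos (k * θ) - 1) * Real.sin θ = 0 := by linarith
      linarith [(mul_eq_zero.1 this).resolve_right hs]
    obtain ⟨n, hn⟩ := (Real.cos_eq_one_iff _).1 e3
    have : (n : ℝ) * m = k := by
      rw [hθ] at hn
      field_simp at hn
      have := Real.pi_ne_zero
      linarith
    have : n * (m : ℤ) = k := by exact_mod_cast this
    exact Int.natCast_dvd_natCast.1 ⟨n, by rw [← this, mul_comm]⟩

end CoxeterMatrix

namespace CoxeterSystem

variable {B W : Type*} [Group W] {M : CoxeterMatrix B} (cs : CoxeterSystem M W)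

theorem dvd_of_simple_mul_simple_pow_eq_one (i j : B) (k : ℕ)
    (h : (cs.simple i * cs.simple j) ^ k = 1) : M i j ∣ k := by
  have hl : M.IsLiftable M.geomReflection := M.geomReflection_mul_pow
  have := congrArg (cs.lift ⟨_, hl⟩) h
  rw [map_pow, map_mul, map_one, lift_apply_simple, lift_apply_simple] at this
  exact M.dvd_of_geomReflection_mul_pow_eq_one i j k this

/-! ### The exchange condition -/

/-- The permutation representation of a simple reflection on `W × ℤ/2`, which counts modulo `2`
occurrences in right inversion sequences. -/
def inversionParityStep (i : B) : Function.End (W × ZMod 2) := fun p =>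
  open Classical in
  (cs.simple i * p.1 * cs.simple i, p.2 + if p.1 = cs.simple i then 1 else 0)

theorem prod_inversionParityStep (ω : List B) (p : W × ZMod 2) :
    open Classical in
    (ω.map cs.inversionParityStep).prod p =
      (cs.wordProd ω * p.1 * (cs.wordProd ω)⁻¹, p.2 + (cs.rightInvSeq ω).count p.1) := by
  classical
  induction ω with
  | nil => simp; rfl
  | cons i ω ih =>
    rw [List.map_cons, List.prod_cons]
    change cs.inversionParityStep i ((ω.map cs.inversionParityStep).prod p) = _
    rw [ih, inversionParityStep]
    have : cs.wordProd ω * p.1 * (cs.wordProd ω)⁻¹ = cs.simple i ↔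
        (cs.wordProd ω)⁻¹ * cs.simple i * cs.wordProd ω = p.1 := by
      constructor <;> intro h
      · rw [← h]; group
      · rw [← h]; group
    simp only [this, rightInvSeq, List.count_cons, wordProd_cons, mul_inv_rev, inv_simple,
      beq_iff_eq]
    ext
    · simp [mul_assoc]
    · push_cast
      simp [add_assoc]

/-- Since `(s_i s_j)^m = 1`, the inversion sequence of this relator is periodic of period `m`, so it
is its first half written twice. This is what makes the parity action respect the Coxeter relations.
-/
theorem even_count_leftInvSeq_alternatingWord [DecidableEq W] (i j : B) (t : W) :
    Even ((cs.leftInvSeq (alternatingWord i j (2 * M i j))).count t) := by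
  set m := M i j with hm
  have : cs.leftInvSeq (alternatingWord i j (2 * m)) =
      (cs.leftInvSeq (alternatingWord i j (2 * m))).take m ++
        (cs.leftInvSeq (alternatingWord i j (2 * m))).take m := by
    apply List.ext_getElem
    · simp; omega
    · intro k h1 h2
      rw [length_leftInvSeq, length_alternatingWord] at h1
      rw [List.getElem_append]
      split_ifs with h
      · simp
      · have hk : m ≤ k := by simpa [show m ≤ 2 * m by omega] using h
        have hl : ((cs.leftInvSeq (alternatingWord i j (2 * m))).take m).length = m := by
          simp; omega
        simp only [hl, List.getElem_take]
        rw [getElem_leftInvSeq_alternatingWord _ _ _ _ _ h1,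
          getElem_leftInvSeq_alternatingWord _ _ _ _ _ (by omega),
          prod_alternatingWord_eq_mul_pow, prod_alternatingWord_eq_mul_pow]
        have e1 : (2 * k + 1) / 2 = (k - m) + m := by omega
        have e2 : (2 * (k - m) + 1) / 2 = k - m := by omega
        rw [e1, e2, pow_add, hm, simple_mul_simple_pow']
        simp
  rw [this, List.count_append]
  exact ⟨_, rfl⟩

theorem reverse_alternatingWord_two_mul (i j : B) (m : ℕ) :
    (alternatingWord i j (2 * m)).reverse = alternatingWord j i (2 * m) := by
  induction m with
  | zero => rfl
  | succ m ih =>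
    rw [show 2 * (m + 1) = 2 * m + 1 + 1 by ring, alternatingWord_succ, alternatingWord_succ,
      alternatingWord_succ' j i, alternatingWord_succ' j i, List.concat_eq_append,
      List.concat_eq_append, List.reverse_append, List.reverse_append, ih]
    simp

theorem prod_map_alternatingWord {N : Type*} [Monoid N] (f : B → N) (i j : B) (m : ℕ) :
    ((alternatingWord i j m).map f).prod =
      (if Even m then 1 else f j) * (f i * f j) ^ (m / 2) := by
  induction m with
  | zero => simp [alternatingWord]
  | succ m ih =>
    rw [alternatingWord_succ', List.map_cons, List.prod_cons, ih]
    by_cases h : Even m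
    · have h1 : (m + 1) / 2 = m / 2 := by
        obtain ⟨k, rfl⟩ := h; omega
      simp [h, Nat.even_add_one, h1]
    · obtain ⟨k, rfl⟩ := Nat.not_even_iff_odd.1 h
      have h1 : (2 * k + 1 + 1) / 2 = k + 1 := by omega
      have h2 : (2 * k + 1) / 2 = k := by omega
      simp [Nat.even_add_one, h1, h2, pow_succ', mul_assoc]

theorem isLiftable_inversionParityStep : M.IsLiftable cs.inversionParityStep := by
  classical
  intro i j
  have h := prod_map_alternatingWord cs.inversionParityStep i j (2 * M i j)
  rw [if_pos (even_two_mul _), one_mul, Nat.mul_div_cancel_left _ two_pos] at h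
  rw [← h]
  funext p
  rw [prod_inversionParityStep, ← reverse_alternatingWord_two_mul, rightInvSeq_reverse,
    List.count_reverse, wordProd_reverse, M.symmetric i j,
    (ZMod.natCast_eq_zero_iff_even).2 (cs.even_count_leftInvSeq_alternatingWord j i p.1),
    prod_alternatingWord_eq_mul_pow, if_pos (even_two_mul _),
    Nat.mul_div_cancel_left _ two_pos, simple_mul_simple_pow]
  simp
  rfl

theorem count_rightInvSeq_congr [DecidableEq W] {ω ω' : List B}
    (h : cs.wordProd ω = cs.wordProd ω') (t : W) :
    ((cs.rightInvSeq ω).count t : ZMod 2) = (cs.rightInvSeq ω').count t := by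
  have key (α : List B) : cs.lift ⟨_, cs.isLiftable_inversionParityStep⟩ (cs.wordProd α) =
      (α.map cs.inversionParityStep).prod := by
    rw [wordProd, map_list_prod, List.map_map]
    congr 1
    apply List.map_congr_left
    intro i _
    exact cs.lift_apply_simple cs.isLiftable_inversionParityStep i
  have := (key ω).symm.trans ((congrArg _ h).trans (key ω'))
  have := congrArg Prod.snd (congrFun this (t, 0))
  rw [prod_inversionParityStep, prod_inversionParityStep] at this
  convert! this using 1 <;> simp <;> congr!

/-- The exchange condition: a right descent of `w` occurs in the right inversion sequence of every
word of `w`. -/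
theorem simple_mem_rightInvSeq {ω : List B} {i : B} (h : cs.IsRightDescent (cs.wordProd ω) i) :
    cs.simple i ∈ cs.rightInvSeq ω := by
  classical
  -- Compare `ω` with the word `α i` of the same element: there `s_i` occurs exactly once, as the
  -- last entry, because an occurrence from `α` would make `s_i` an inversion of `w s_i`. An odd
  -- count in `ω` cannot be zero.
  obtain ⟨α, hα, hαw⟩ := cs.exists_isReduced (cs.wordProd ω * cs.simple i)
  have hn : cs.simple i ∉ cs.rightInvSeq α := fun hm => by
    have := (cs.isRightInversion_of_mem_rightInvSeq hα hm).2
    rw [← hαw, simple_mul_simple_cancel_right] at this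
    exact absurd h (not_lt_of_gt this)
  have hω : cs.wordProd ω = cs.wordProd (α.concat i) := by
    rw [wordProd_concat, ← hαw, simple_mul_simple_cancel_right]
  have hc := cs.count_rightInvSeq_congr hω (cs.simple i)
  rw [rightInvSeq_concat, List.concat_eq_append, List.count_append,
    (List.count_eq_zero (l := List.map _ _)).2] at hc
  · by_contra hm
    rw [List.count_eq_zero.2 hm] at hc
    simp at hc
  · intro hm
    obtain ⟨t, ht, hti⟩ := List.mem_map.1 hm
    apply hn
    convert ht using 1
    rw [MulAut.conj_apply] at hti
    calc cs.simple i = (cs.simple i)⁻¹ * cs.simple i * cs.simple i := by group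
      _ = (cs.simple i)⁻¹ * (cs.simple i * t * (cs.simple i)⁻¹) * cs.simple i := by rw [hti]
      _ = t := by group

end CoxeterSystem

end

noncomputable section

namespace CoxeterSystem

variable {B W : Type*} [Group W] {M : CoxeterMatrix B} (cs : CoxeterSystem M W)

/-! ### Dihedral parabolic subgroups -/

theorem mem_rightInvSeq_append {ω ω' : List B} {t : W}
    (ht : t ∈ cs.rightInvSeq (ω ++ ω')) :
    cs.wordProd ω' * t * (cs.wordProd ω')⁻¹ ∈ cs.rightInvSeq ω ∨ t ∈ cs.rightInvSeq ω' := by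
  induction ω with
  | nil => exact Or.inr ht
  | cons i ω ih =>
    rw [List.cons_append, rightInvSeq, List.mem_cons] at ht
    rcases ht with rfl | ht
    · left
      rw [rightInvSeq, wordProd_append, List.mem_cons]
      left
      group
    · exact (ih ht).imp_left fun h => List.mem_cons_of_mem _ h

theorem mem_rightInvSeq_alternatingWord {i j : B} {k : ℕ} {t : W}
    (ht : t ∈ cs.rightInvSeq (alternatingWord i j k)) :
    ∃ q < k, t = cs.simple j * (cs.simple i * cs.simple j) ^ q := by
  induction k generalizing i j t with
  | zero => simp [alternatingWord] at ht
  | succ k ih =>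
    rw [alternatingWord_succ, rightInvSeq_concat, List.concat_eq_append, List.mem_append] at ht
    rcases ht with ht | ht
    · obtain ⟨u, hu, rfl⟩ := List.mem_map.1 ht
      obtain ⟨q, hq, rfl⟩ := ih hu
      refine ⟨q + 1, by omega, ?_⟩
      rw [MulAut.conj_apply, inv_simple, pow_succ', mul_assoc, mul_assoc, mul_assoc, mul_pow_mul]
    · exact ⟨0, by omega, by simpa using ht⟩

/-- An occurrence would give `(s_j s_i)^(q+1) = 1` with `0 < q + 1 ≤ k`, against the order of `s_j
s_i`. -/
theorem simple_notMem_rightInvSeq_alternatingWord {i j : B} {k : ℕ}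
    (hk : M i j ≠ 0 → k < M i j) :
    cs.simple j ∉ cs.rightInvSeq (alternatingWord j i k) := by
  intro h
  obtain ⟨q, hq, hj⟩ := cs.mem_rightInvSeq_alternatingWord h
  have h1 : (cs.simple j * cs.simple i) ^ (q + 1) = 1 := by
    rw [pow_succ', mul_assoc, ← hj, simple_mul_simple_self]
  have h2 := cs.dvd_of_simple_mul_simple_pow_eq_one j i _ h1
  rw [M.symmetric j i] at h2
  have h3 := Nat.le_of_dvd (by omega) h2
  by_cases h0 : M i j = 0
  · rw [h0] at h2
    omega
  · have := hk h0
    omega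

/-- If `i` and `j` are right descents of `w`, then `w` has a reduced word ending with any
alternating word in `i`, `j` of length at most `m(i,j)`. -/
theorem exists_eq_mul_alternatingWord {w : W} (k : ℕ) {i j : B}
    (hi : cs.IsRightDescent w i) (hj : cs.IsRightDescent w j) (hk : M i j ≠ 0 → k ≤ M i j) :
    ∃ v, w = v * cs.wordProd (alternatingWord i j k) ∧ cs.length w = cs.length v + k := by
  induction k generalizing i j with
  | zero => exact ⟨w, by simp [alternatingWord], rfl⟩
  | succ k ih =>
    -- With `i` and `j` swapped, the known ending is in the letter `i`. The exchange condition for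
    -- `j` deletes a letter, which must lie in `α` and not in the dihedral part; appending `j` then
    -- lengthens the dihedral part by one.
    obtain ⟨v, hv, hl⟩ := ih hj hi (fun h => by rw [M.symmetric] at h ⊢; have := hk h; omega)
    obtain ⟨α, hα, rfl⟩ := cs.exists_isReduced v
    have hw : w = cs.wordProd (α ++ alternatingWord j i k) := by rw [wordProd_append, ← hv]
    rcases cs.mem_rightInvSeq_append (cs.simple_mem_rightInvSeq (hw ▸ hj)) with h | h
    · set a := cs.wordProd (alternatingWord j i k) with ha
      set t := a * cs.simple j * a⁻¹ with ht
      have hlt := (cs.isRightInversion_of_mem_rightInvSeq hα h).2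
      have heq : w = cs.wordProd α * t * cs.wordProd (alternatingWord i j (k + 1)) := by
        rw [alternatingWord_succ, wordProd_concat, ← ha, hv, ht]
        simp [mul_assoc]
      refine ⟨_, heq, ?_⟩
      have h1 := cs.length_mul_le (cs.wordProd α * t) (cs.wordProd (alternatingWord i j (k + 1)))
      have h2 := cs.length_wordProd_le (alternatingWord i j (k + 1))
      rw [← heq] at h1
      rw [length_alternatingWord] at h2
      omega
    · exact absurd h (cs.simple_notMem_rightInvSeq_alternatingWord fun h => hk h)

/-- If `m(i,j) = ∞`, then `w` would end reducedly in alternating words of every length, even longer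
than `w`. -/
theorem exists_eq_mul_braidWord {w : W} {i j : B}
    (hi : cs.IsRightDescent w i) (hj : cs.IsRightDescent w j) :
    M i j ≠ 0 ∧ ∃ v, w = v * cs.wordProd (alternatingWord i j (M i j)) ∧
      cs.length w = cs.length v + M i j := by
  refine ⟨fun h => ?_, cs.exists_eq_mul_alternatingWord _ hi hj fun _ => le_rfl⟩
  obtain ⟨v, -, hv⟩ := cs.exists_eq_mul_alternatingWord (cs.length w + 1) hi hj
    fun h' => absurd h h'
  omega

theorem wordProd_alternatingWord_comm (i j : B) :
    cs.wordProd (alternatingWord i j (M i j)) = cs.wordProd (alternatingWord j i (M i j)) := by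
  conv_rhs => rw [M.symmetric i j]
  exact cs.wordProd_braidWord_eq i j

/-! ### Matsumoto's theorem -/

theorem IsReduced.of_concat {cs : CoxeterSystem M W} {ω : List B} {i : B}
    (h : cs.IsReduced (ω.concat i)) : cs.IsReduced ω := by
  have := h.take ω.length
  rwa [List.concat_eq_append, List.take_left] at this

theorem IsReduced.isRightDescent_concat {cs : CoxeterSystem M W} {ω : List B} {i : B}
    (h : cs.IsReduced (ω.concat i)) : cs.IsRightDescent (cs.wordProd (ω.concat i)) i := by
  rw [IsRightDescent, h.eq, wordProd_concat, simple_mul_simple_cancel_right, h.of_concat.eq]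
  simp

theorem isReduced_concat_iff {ω : List B} (hω : cs.IsReduced ω) (i : B) :
    cs.IsReduced (ω.concat i) ↔ ¬ cs.IsRightDescent (cs.wordProd ω) i := by
  rw [not_isRightDescent_iff, IsReduced, wordProd_concat, hω.eq, List.length_concat]

/-- Matsumoto's theorem: the product along a reduced word of a family satisfying the braid
relations depends only on the element of the Coxeter group. -/
theorem IsReduced.prod_map_eq {cs : CoxeterSystem M W} {N : Type*} [Monoid N] {f : B → N}
    (hf : ∀ i j, M i j ≠ 0 → ((alternatingWord i j (M i j)).map f).prod =
      ((alternatingWord j i (M i j)).map f).prod)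
    {ω ω' : List B} (hω : cs.IsReduced ω) (hω' : cs.IsReduced ω')
    (h : cs.wordProd ω = cs.wordProd ω') : (ω.map f).prod = (ω'.map f).prod := by
  induction hn : ω.length generalizing ω ω' with
  | zero =>
    have h' : ω'.length = 0 := by rw [← hω'.eq, ← h, hω.eq, hn]
    rw [List.length_eq_zero_iff.1 hn, List.length_eq_zero_iff.1 h']
  | succ n ih =>
    have cancel {α β : List B} {i : B} (hα : cs.IsReduced (α.concat i))
        (hβ : cs.IsReduced (β.concat i)) (hαβ : cs.wordProd (α.concat i) = cs.wordProd (β.concat i))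
        (hl : (α.concat i).length = n + 1) :
        ((α.concat i).map f).prod = ((β.concat i).map f).prod := by
      have := ih hα.of_concat hβ.of_concat
        (by rw [wordProd_concat, wordProd_concat] at hαβ; exact mul_right_cancel hαβ) (by simpa using hl)
      simp [this]
    have hn' : ω'.length = n + 1 := by rw [← hω'.eq, ← h, hω.eq, hn]
    rcases List.eq_nil_or_concat ω with rfl | ⟨α, i, hα⟩
    · simp at hn
    rcases List.eq_nil_or_concat ω' with rfl | ⟨β, j, hβ⟩
    · simp at hn'
    subst hα hβ
    have hi := hω.isRightDescent_concat
    have hj := hω'.isRightDescent_concat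
    rw [← h] at hj
    -- The two reduced words `γ ⋯ i j` and `γ ⋯ j i` differ by one braid relation. The second shares
    -- its last letter with `ω` and the first with `ω'`, so `cancel` links all four.
    obtain ⟨h0, v, hv, hl⟩ := cs.exists_eq_mul_braidWord hi hj
    obtain ⟨γ, hγ, rfl⟩ := cs.exists_isReduced v
    have hv' := hv
    rw [wordProd_alternatingWord_comm] at hv'
    have hred (x y : B) (hxy : cs.wordProd (α.concat i) =
        cs.wordProd γ * cs.wordProd (alternatingWord x y (M i j))) :
        cs.IsReduced (γ ++ alternatingWord x y (M i j)) := by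
      rw [IsReduced, wordProd_append, ← hxy, hl, hγ.eq, List.length_append, length_alternatingWord]
    have hr1 := hred i j hv
    have hr2 := hred j i hv'
    have hfe := hf i j h0
    rw [← wordProd_append] at hv hv'
    have hG : ((γ ++ alternatingWord i j (M i j)).map f).prod =
        ((γ ++ alternatingWord j i (M i j)).map f).prod := by simp [hfe]
    have hsplit (x y : B) : ∃ δ : List B, γ ++ alternatingWord x y (M i j) = δ.concat y := by
      obtain ⟨m, hm⟩ := Nat.exists_eq_succ_of_ne_zero h0
      refine ⟨γ ++ alternatingWord y x m, ?_⟩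
      rw [hm, Nat.succ_eq_add_one, alternatingWord_succ, List.concat_eq_append,
        List.concat_eq_append, List.append_assoc]
    obtain ⟨δ, hδ⟩ := hsplit i j
    obtain ⟨ε, hε⟩ := hsplit j i
    rw [hδ] at hv hr1 hG
    rw [hε] at hv' hr2 hG
    rw [cancel hω hr2 hv' hn, ← hG, ← cancel hω' hr1 (h.symm.trans hv) hn']

/-! ### The projections `P^{s}` on `W` -/

open Classical in
/-- The map `w ↦ min (w, w s)`. -/
def down (i : B) (w : W) : W := if cs.IsRightDescent w i then w * cs.simple i else w

theorem down_of_isRightDescent {i : B} {w : W} (h : cs.IsRightDescent w i) :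
    cs.down i w = w * cs.simple i := if_pos h

theorem down_of_not_isRightDescent {i : B} {w : W} (h : ¬ cs.IsRightDescent w i) :
    cs.down i w = w := if_neg h

/-- As `W_{s} = {1, s}`, the chosen factor is `w` or `w s`, and minimality decides which. -/
theorem proj_singleton (i : B) : cs.proj {i} = cs.down i := by
  funext w
  obtain ⟨hx, y, hy, hw⟩ := (cs.exists_parabolic_factorization {i} w).choose_spec
  change cs.proj {i} w ∈ _ at hx
  change w = cs.proj {i} w * y at hw
  have hx' := hx i rfl
  have hy' : y = 1 ∨ y = cs.simple i := by
    rw [parabolic, Set.image_singleton] at hy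
    clear hw
    induction hy using Subgroup.closure_induction with
    | mem x hx => exact Or.inr hx
    | one => exact Or.inl rfl
    | mul x y _ _ hx hy => rcases hx with rfl | rfl <;> rcases hy with rfl | rfl <;> simp
    | inv x _ hx => rcases hx with rfl | rfl <;> simp
  rcases hy' with rfl | rfl
  · rw [mul_one] at hw
    rw [← hw, down_of_not_isRightDescent]
    rw [IsRightDescent]
    rw [← hw] at hx'
    omega
  · rw [down_of_isRightDescent]
    · conv_rhs => rw [hw, simple_mul_simple_cancel_right]
    · rw [IsRightDescent]
      conv_lhs => rw [hw, simple_mul_simple_cancel_right]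
      conv_rhs => rw [hw]
      exact hx'

theorem not_isRightDescent_down (i : B) (w : W) : ¬ cs.IsRightDescent (cs.down i w) i := by
  by_cases h : cs.IsRightDescent w i
  · rw [down_of_isRightDescent _ h]
    exact cs.isRightDescent_iff_not_isRightDescent_mul.1 h
  · rwa [down_of_not_isRightDescent _ h]

theorem down_down (i : B) (w : W) : cs.down i (cs.down i w) = cs.down i w :=
  cs.down_of_not_isRightDescent (cs.not_isRightDescent_down i w)

theorem length_le_length_down (i : B) (w : W) : cs.length w ≤ cs.length (cs.down i w) + 1 := by
  by_cases h : cs.IsRightDescent w i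
  · rw [down_of_isRightDescent _ h]
    exact (cs.isRightDescent_iff.1 h).ge
  · rw [down_of_not_isRightDescent _ h]
    omega

/-- The action on `W` of a word, the last letter acting first. -/
def downWord (ω : List B) (w : W) : W := ω.foldr cs.down w

theorem downWord_cons (i : B) (ω : List B) (w : W) :
    cs.downWord (i :: ω) w = cs.down i (cs.downWord ω w) := rfl

theorem downWord_concat (i : B) (ω : List B) (w : W) :
    cs.downWord (ω.concat i) w = cs.downWord ω (cs.down i w) := by
  simp [downWord, List.concat_eq_append]

theorem downWord_eq_self {ω : List B} {w : W} (h : ∀ i ∈ ω, ¬ cs.IsRightDescent w i) :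
    cs.downWord ω w = w := by
  induction ω with
  | nil => rfl
  | cons i ω ih =>
    rw [downWord_cons, ih fun j hj => h j (List.mem_cons_of_mem _ hj),
      down_of_not_isRightDescent _ (h i List.mem_cons_self)]

theorem downWord_mul_wordProd {ω : List B} {v : W}
    (h : cs.length (v * cs.wordProd ω) = cs.length v + ω.length) :
    cs.downWord ω (v * cs.wordProd ω) = v := by
  induction ω generalizing v with
  | nil => simp [downWord]
  | cons i ω ih =>
    rw [wordProd_cons, ← mul_assoc, List.length_cons] at h
    have h1 := cs.length_mul_le (v * cs.simple i) (cs.wordProd ω)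
    have h2 := cs.length_wordProd_le ω
    have h3 : cs.length (v * cs.simple i) = cs.length v + 1 := by
      rcases cs.length_mul_simple v i with h | h <;> omega
    rw [downWord_cons, wordProd_cons, ← mul_assoc, ih (by omega), down_of_isRightDescent,
      simple_mul_simple_cancel_right]
    rw [IsRightDescent, simple_mul_simple_cancel_right]
    omega

theorem length_le_length_downWord (ω : List B) (w : W) :
    cs.length w ≤ cs.length (cs.downWord ω w) + ω.length := by
  induction ω with
  | nil => exact le_rfl
  | cons i ω ih =>
    have := cs.length_le_length_down i (cs.downWord ω w)
    rw [downWord_cons, List.length_cons]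
    omega

/-- If the length drops by the maximal amount, every letter acts as a true right multiplication, and
these can be undone. -/
theorem eq_mul_wordProd_of_length_downWord {ω : List B} {w : W}
    (h : cs.length w = cs.length (cs.downWord ω w) + ω.length) :
    w = cs.downWord ω w * cs.wordProd ω := by
  induction ω with
  | nil => simp [downWord]
  | cons i ω ih =>
    have h1 := cs.length_le_length_down i (cs.downWord ω w)
    have h2 := cs.length_le_length_downWord ω w
    rw [downWord_cons, List.length_cons] at h
    have h3 : cs.IsRightDescent (cs.downWord ω w) i := by
      by_contra hn
      rw [down_of_not_isRightDescent _ hn] at h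
      omega
    rw [downWord_cons, down_of_isRightDescent _ h3, wordProd_cons, mul_assoc,
      simple_mul_simple_cancel_left]
    exact ih (by omega)

/-- The last `k` letters of an alternating word of length `d + k`. -/
theorem exists_alternatingWord_add (i j : B) (d k : ℕ) :
    ∃ ω : List B, (∀ x ∈ ω, x = i ∨ x = j) ∧ ω.length = d ∧
      alternatingWord i j (d + k) = ω ++ alternatingWord i j k := by
  induction d with
  | zero => exact ⟨[], by simp, rfl, by simp⟩
  | succ d ih =>
    obtain ⟨ω, hω, hl, h⟩ := ih
    refine ⟨(if Even (d + k) then j else i) :: ω, fun x hx => ?_, by simp [hl], ?_⟩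
    · rcases List.mem_cons.1 hx with rfl | hx
      · split_ifs <;> simp
      · exact hω x hx
    · rw [show d + 1 + k = d + k + 1 by ring, alternatingWord_succ', h, List.cons_append]

/-- Strips off descents in `{i, j}` until none is left. A stripped letter is no longer a descent, so
the letters alternate, starting with `j` from the right. -/
theorem exists_eq_mul_alternatingWord_of_not_isRightDescent {w : W} {i j : B}
    (hi : ¬ cs.IsRightDescent w i) :
    ∃ v k, ¬ cs.IsRightDescent v i ∧ ¬ cs.IsRightDescent v j ∧
      w = v * cs.wordProd (alternatingWord i j k) ∧ cs.length w = cs.length v + k := by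
  induction hn : cs.length w using Nat.strong_induction_on generalizing w i j with
  | _ n ih =>
    by_cases hj : cs.IsRightDescent w j
    · have hl := cs.isRightDescent_iff.1 hj
      obtain ⟨v, k, hvj, hvi, hw, hk⟩ := ih (cs.length (w * cs.simple j)) (by omega)
        (cs.isRightDescent_iff_not_isRightDescent_mul.1 hj) (j := i) rfl
      refine ⟨v, k + 1, hvi, hvj, ?_, by omega⟩
      rw [alternatingWord_succ, wordProd_concat, ← mul_assoc, ← hw,
        simple_mul_simple_cancel_right]
    · exact ⟨w, 0, hi, hj, by simp [alternatingWord], hn.symm⟩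

/-- Both sides equal the shortest element `v` of the coset `w W_{i,j}`. If `w = v ⋯ i j` does not
have `i` as a descent, the word ending in `i` wastes its first action, but `m - 1` letters still
suffice. -/
theorem downWord_alternatingWord_comm (i j : B) (h0 : M i j ≠ 0) (w : W) :
    cs.downWord (alternatingWord i j (M i j)) w = cs.downWord (alternatingWord j i (M i j)) w := by
  have main {i j : B} (h0 : M i j ≠ 0) (hi : ¬ cs.IsRightDescent w i) :
      cs.downWord (alternatingWord i j (M i j)) w =
        cs.downWord (alternatingWord j i (M i j)) w := by
    obtain ⟨v, k, hvi, hvj, hw, hl⟩ :=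
      cs.exists_eq_mul_alternatingWord_of_not_isRightDescent (j := j) hi
    have hdown {n : ℕ} (hn : k ≤ n) : cs.downWord (alternatingWord i j n) w = v := by
      obtain ⟨d, rfl⟩ := Nat.exists_eq_add_of_le' hn
      obtain ⟨ω, hω, -, h⟩ := exists_alternatingWord_add i j d k
      have hv : cs.downWord (alternatingWord i j k) w = v := by
        rw [hw]
        apply cs.downWord_mul_wordProd
        rw [← hw, hl, length_alternatingWord]
      have : cs.downWord (ω ++ alternatingWord i j k) w =
          cs.downWord ω (cs.downWord (alternatingWord i j k) w) := by
        simp [downWord]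
      rw [h, this, hv]
      apply downWord_eq_self
      intro x hx
      rcases hω x hx with rfl | rfl <;> assumption
    obtain ⟨m, hm⟩ := Nat.exists_eq_succ_of_ne_zero h0
    -- Here `m + 1 = M i j`. A longer alternating ending would contain the full braid word, which
    -- can be rewritten to end in `i`, making `i` a descent.
    have hk : k ≤ m := by
      by_contra hlt
      obtain ⟨d, rfl⟩ := Nat.exists_eq_add_of_le' (show M i j ≤ k by omega)
      obtain ⟨ω, -, hωl, h⟩ := exists_alternatingWord_add i j d (M i j)
      apply hi
      rw [h, wordProd_append, wordProd_alternatingWord_comm, hm, Nat.succ_eq_add_one,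
        alternatingWord_succ, wordProd_concat] at hw
      rw [IsRightDescent, hl]
      have hw' : w * cs.simple i =
          v * (cs.wordProd ω * cs.wordProd (alternatingWord i j m)) := by
        rw [hw]
        simp [mul_assoc]
      have h1 := cs.length_mul_le v (cs.wordProd ω * cs.wordProd (alternatingWord i j m))
      have h2 := cs.length_mul_le (cs.wordProd ω) (cs.wordProd (alternatingWord i j m))
      have h3 := cs.length_wordProd_le ω
      have h4 := cs.length_wordProd_le (alternatingWord i j m)
      rw [length_alternatingWord] at h4
      rw [hw']
      omega
    rw [hdown (by omega), hm, Nat.succ_eq_add_one, alternatingWord_succ, downWord_concat,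
      down_of_not_isRightDescent _ hi, hdown hk]
  by_cases hi : cs.IsRightDescent w i
  · by_cases hj : cs.IsRightDescent w j
    · obtain ⟨-, v, hw, hl⟩ := cs.exists_eq_mul_braidWord hi hj
      have hw' := hw
      rw [wordProd_alternatingWord_comm] at hw'
      trans v
      · conv_lhs => rw [hw]
        apply cs.downWord_mul_wordProd
        rw [← hw, hl, length_alternatingWord]
      · conv_rhs => rw [hw']
        apply Eq.symm
        apply cs.downWord_mul_wordProd
        rw [← hw', hl, length_alternatingWord]
    · have := main (i := j) (j := i) (M.symmetric i j ▸ h0) hj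
      rw [M.symmetric j i] at this
      exact this.symm
  · exact main h0 hi

end CoxeterSystem

end

/-! ### Braid relations and universal properties -/

noncomputable section

namespace CoxeterSystem

theorem prod_map_alternatingWord_of_even {B N : Type*} [Monoid N] (f : B → N) (i j : B) {m : ℕ}
    (h : Even m) : ((alternatingWord i j m).map f).prod = (f i * f j) ^ (m / 2) := by
  rw [prod_map_alternatingWord, if_pos h, one_mul]

theorem prod_map_alternatingWord_of_odd {B N : Type*} [Monoid N] (f : B → N) (i j : B) {m : ℕ}
    (h : Odd m) :
    ((alternatingWord i j m).map f).prod = f j * (f i * f j) ^ ((m - 1) / 2) := by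
  rw [prod_map_alternatingWord, if_neg (Nat.not_even_iff_odd.2 h)]
  obtain ⟨k, rfl⟩ := h
  congr 2
  omega

end CoxeterSystem

namespace CoxeterMatrix

open CoxeterSystem

variable {B : Type*} (M : CoxeterMatrix B)

/-- A family indexed by the generators satisfies the braid relations of a Coxeter matrix. -/
def IsBraided {N : Type*} [Monoid N] (f : B → N) : Prop :=
  ∀ i j, M i j ≠ 0 → ((alternatingWord i j (M i j)).map f).prod =
    ((alternatingWord j i (M i j)).map f).prod

variable {M}

theorem IsBraided.even {N : Type*} [Monoid N] {f : B → N} (hf : M.IsBraided f) {i j : B}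
    (h0 : M i j ≠ 0) (h : Even (M i j)) : (f i * f j) ^ (M i j / 2) = (f j * f i) ^ (M i j / 2) := by
  rw [← prod_map_alternatingWord_of_even f i j h, ← prod_map_alternatingWord_of_even f j i h,
    hf i j h0]

theorem IsBraided.odd {N : Type*} [Monoid N] {f : B → N} (hf : M.IsBraided f) {i j : B}
    (h : Odd (M i j)) :
    f j * (f i * f j) ^ ((M i j - 1) / 2) = f i * (f j * f i) ^ ((M i j - 1) / 2) := by
  rw [← prod_map_alternatingWord_of_odd f i j h, ← prod_map_alternatingWord_of_odd f j i h,
    hf i j h.pos.ne']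

theorem isBraided_of_even_of_odd {N : Type*} [Monoid N] {f : B → N}
    (he : ∀ i j, M i j ≠ 0 → Even (M i j) →
      (f i * f j) ^ (M i j / 2) = (f j * f i) ^ (M i j / 2))
    (ho : ∀ i j, Odd (M i j) →
      f j * (f i * f j) ^ ((M i j - 1) / 2) = f i * (f j * f i) ^ ((M i j - 1) / 2)) :
    M.IsBraided f := by
  intro i j h0
  rcases Nat.even_or_odd (M i j) with h | h
  · rw [prod_map_alternatingWord_of_even f i j h, prod_map_alternatingWord_of_even f j i h,
      he i j h0 h]
  · rw [prod_map_alternatingWord_of_odd f i j h, prod_map_alternatingWord_of_odd f j i h,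
      ho i j h]

theorem isBraided_monoidGen : M.IsBraided M.monoidGen := by
  refine isBraided_of_even_of_odd (fun i j h0 h => ?_) (fun i j h => ?_)
  · simpa [monoidGen, PresentedMonoid.of] using
      PresentedMonoid.mk_eq_mk_of_rel (MonoidRel.even i j h0 h)
  · simpa [monoidGen, PresentedMonoid.of] using
      PresentedMonoid.mk_eq_mk_of_rel (MonoidRel.odd i j h)

theorem monoidGen_mul_self (s : B) : M.monoidGen s * M.monoidGen s = M.monoidGen s :=
  PresentedMonoid.mk_eq_mk_of_rel (MonoidRel.idem s)

theorem isBraided_zeroHeckeGen : M.IsBraided M.zeroHeckeGen := by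
  refine isBraided_of_even_of_odd (fun i j h0 h => ?_) (fun i j h => ?_)
  · simpa [zeroHeckeGen] using RingQuot.mkAlgHom_rel ℤ (HeckeRel.even (q := (0 : ℤ)) i j h0 h)
  · simpa [zeroHeckeGen] using RingQuot.mkAlgHom_rel ℤ (HeckeRel.odd (q := (0 : ℤ)) i j h)

theorem zeroHeckeGen_mul_self (s : B) :
    M.zeroHeckeGen s * M.zeroHeckeGen s = -M.zeroHeckeGen s := by
  simpa [zeroHeckeGen] using RingQuot.mkAlgHom_rel ℤ (HeckeRel.quadratic (M := M) (q := (0 : ℤ)) s)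

theorem prod_map_neg_eq_smul {B R : Type*} [Ring R] (f : B → R) (ω : List B) :
    (ω.map fun s => -f s).prod = (-1 : ℤ) ^ ω.length • (ω.map f).prod := by
  induction ω with
  | nil => simp
  | cons i ω ih =>
    simp only [List.map_cons, List.prod_cons, ih, List.length_cons, pow_succ', mul_smul,
      neg_mul, mul_smul_comm, neg_smul, one_smul, smul_neg]

theorem IsBraided.neg {R : Type*} [Ring R] {f : B → R} (hf : M.IsBraided f) :
    M.IsBraided fun s => -f s := by
  intro i j h0
  rw [prod_map_neg_eq_smul, prod_map_neg_eq_smul, hf i j h0, length_alternatingWord,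
    length_alternatingWord]

/-- The homomorphism out of the Coxeter monoid given by a braided family of idempotents. -/
def monoidLift {N : Type*} [Monoid N] {f : B → N} (hf : M.IsBraided f)
    (hi : ∀ s, f s * f s = f s) : M.CoxeterMonoid →* N :=
  PresentedMonoid.lift f fun a b h => by
    cases h with
    | idem s => simpa using hi s
    | even s t h0 h => simpa using hf.even h0 h
    | odd s t h => simpa using hf.odd h

theorem monoidLift_monoidGen {N : Type*} [Monoid N] {f : B → N} (hf : M.IsBraided f)
    (hi : ∀ s, f s * f s = f s) (s : B) : monoidLift hf hi (M.monoidGen s) = f s :=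
  PresentedMonoid.lift_of f _ (x := s)

/-- The homomorphism out of the `0`-Hecke algebra given by a braided family of elements with
`a² = -a`. -/
def zeroHeckeLift {A : Type*} [Ring A] {f : B → A} (hf : M.IsBraided f)
    (hi : ∀ s, f s * f s = -f s) : M.ZeroHeckeAlgebra →ₐ[ℤ] A :=
  RingQuot.liftAlgHom ℤ ⟨FreeAlgebra.lift ℤ f, fun a b h => by
    cases h with
    | quadratic s => simpa using hi s
    | even s t h0 h => simpa using hf.even h0 h
    | odd s t h => simpa using hf.odd h⟩

theorem zeroHeckeLift_mkAlgHom {A : Type*} [Ring A] {f : B → A} (hf : M.IsBraided f)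
    (hi : ∀ s, f s * f s = -f s) (x : FreeAlgebra ℤ B) :
    zeroHeckeLift hf hi (RingQuot.mkAlgHom ℤ (M.HeckeRel (0 : ℤ)) x) = FreeAlgebra.lift ℤ f x :=
  RingQuot.liftAlgHom_mkAlgHom_apply _ _ _ _

theorem zeroHeckeLift_zeroHeckeGen {A : Type*} [Ring A] {f : B → A} (hf : M.IsBraided f)
    (hi : ∀ s, f s * f s = -f s) (s : B) : zeroHeckeLift hf hi (M.zeroHeckeGen s) = f s := by
  rw [zeroHeckeGen, zeroHeckeLift_mkAlgHom, FreeAlgebra.lift_ι_apply]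

theorem range_zeroHeckeLift {A : Type*} [Ring A] {f : B → A} (hf : M.IsBraided f)
    (hi : ∀ s, f s * f s = -f s) :
    (zeroHeckeLift hf hi).range = Algebra.adjoin ℤ (Set.range f) := by
  rw [Algebra.adjoin_range_eq_range_freeAlgebra_lift]
  ext x
  constructor
  · rintro ⟨y, rfl⟩
    obtain ⟨z, rfl⟩ := RingQuot.mkAlgHom_surjective ℤ _ y
    exact ⟨z, (zeroHeckeLift_mkAlgHom hf hi z).symm⟩
  · rintro ⟨z, rfl⟩
    exact ⟨_, zeroHeckeLift_mkAlgHom hf hi z⟩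

end CoxeterMatrix

namespace CoxeterSystem

open CoxeterMatrix

variable {B W : Type*} [Group W] {M : CoxeterMatrix B} (cs : CoxeterSystem M W)

/-! ### Products along reduced words -/

theorem isReduced_reducedWord (u : W) : cs.IsReduced (cs.reducedWord u) :=
  (cs.exists_isReduced u).choose_spec.1

theorem wordProd_reducedWord (u : W) : cs.wordProd (cs.reducedWord u) = u :=
  (cs.exists_isReduced u).choose_spec.2.symm

theorem length_reducedWord (u : W) : (cs.reducedWord u).length = cs.length u := by
  rw [← (cs.isReduced_reducedWord u).eq, wordProd_reducedWord]

/-- The product of a family along the chosen reduced word of an element. -/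
def reducedProd {N : Type*} [Monoid N] (f : B → N) (u : W) : N := ((cs.reducedWord u).map f).prod

section ReducedProd

variable {N : Type*} [Monoid N] {f : B → N}

theorem reducedProd_wordProd (hf : M.IsBraided f) {ω : List B} (hω : cs.IsReduced ω) :
    cs.reducedProd f (cs.wordProd ω) = (ω.map f).prod :=
  (cs.isReduced_reducedWord _).prod_map_eq hf hω (cs.wordProd_reducedWord _)

theorem reducedProd_one (hf : M.IsBraided f) : cs.reducedProd f 1 = 1 := by
  simpa using cs.reducedProd_wordProd hf (ω := []) (by simp [IsReduced])

theorem reducedProd_simple (hf : M.IsBraided f) (s : B) : cs.reducedProd f (cs.simple s) = f s := by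
  simpa using cs.reducedProd_wordProd hf (ω := [s]) (by simp [IsReduced])

theorem reducedProd_mul_of_not_isRightDescent (hf : M.IsBraided f) {w : W} {s : B}
    (h : ¬ cs.IsRightDescent w s) :
    cs.reducedProd f w * f s = cs.reducedProd f (w * cs.simple s) := by
  have hr := cs.isReduced_reducedWord w
  have hr' := (cs.isReduced_concat_iff hr s).2 (by rwa [wordProd_reducedWord])
  have := cs.reducedProd_wordProd hf hr'
  rw [wordProd_concat, wordProd_reducedWord] at this
  rw [this, List.concat_eq_append, List.map_append, List.prod_append, List.map_singleton,
    List.prod_singleton, reducedProd]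

theorem reducedProd_of_isRightDescent (hf : M.IsBraided f) {w : W} {s : B}
    (h : cs.IsRightDescent w s) :
    cs.reducedProd f w = cs.reducedProd f (w * cs.simple s) * f s := by
  rw [cs.reducedProd_mul_of_not_isRightDescent hf
    (cs.isRightDescent_iff_not_isRightDescent_mul.1 h), simple_mul_simple_cancel_right]

theorem map_reducedProd {N' F : Type*} [Monoid N'] [FunLike F N N'] [MonoidHomClass F N N']
    (φ : F) (u : W) : φ (cs.reducedProd f u) = cs.reducedProd (fun s => φ (f s)) u := by
  rw [reducedProd, reducedProd, map_list_prod, List.map_map]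
  rfl

end ReducedProd

/-- The image contains `1` and is stable under right multiplication by a generator `s`: either the
reduced word extends, or it can be chosen to end in `s` and idempotency absorbs the new letter. -/
theorem toMonoid_surjective : Function.Surjective cs.toMonoid := by
  change Function.Surjective (cs.reducedProd M.monoidGen)
  have hf := isBraided_monoidGen (M := M)
  intro x
  have hx : x ∈ Submonoid.closure (Set.range M.monoidGen) := by
    have := PresentedMonoid.closure_range_of M.MonoidRel
    exact this ▸ Submonoid.mem_top x
  induction hx using Submonoid.closure_induction_right with
  | one => exact ⟨1, cs.reducedProd_one hf⟩
  | mul_right x _ y hy ih =>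
    obtain ⟨w, rfl⟩ := ih
    obtain ⟨s, rfl⟩ := hy
    by_cases h : cs.IsRightDescent w s
    · exact ⟨w, by rw [cs.reducedProd_of_isRightDescent hf h, mul_assoc, monoidGen_mul_self]⟩
    · exact ⟨w * cs.simple s, (cs.reducedProd_mul_of_not_isRightDescent hf h).symm⟩

/-! ### The endomorphisms `P^u` -/

theorem projEnd_singleton_single (i : B) (w : W) (c : ℤ) :
    cs.projEnd {i} (Finsupp.single w c) = Finsupp.single (cs.down i w) c := by
  rw [projEnd, Finsupp.lmapDomain_apply, Finsupp.mapDomain_single, proj_singleton]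

theorem prod_projEnd_single (ω : List B) (w : W) (c : ℤ) :
    (ω.map fun s => cs.projEnd {s}).prod (Finsupp.single w c) =
      Finsupp.single (cs.downWord ω w) c := by
  induction ω with
  | nil => simp [downWord]
  | cons i ω ih =>
    rw [List.map_cons, List.prod_cons, Module.End.mul_apply, ih, projEnd_singleton_single,
      downWord_cons]

theorem isBraided_projEnd : M.IsBraided fun s => cs.projEnd {s} := by
  intro i j h0
  refine Finsupp.lhom_ext fun w c => ?_
  rw [prod_projEnd_single, prod_projEnd_single, downWord_alternatingWord_comm _ _ _ h0]

theorem projEnd_mul_self (s : B) : cs.projEnd {s} * cs.projEnd {s} = cs.projEnd {s} := by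
  refine Finsupp.lhom_ext fun w c => ?_
  rw [Module.End.mul_apply, projEnd_singleton_single, projEnd_singleton_single, down_down]

theorem projElem_single (u w : W) (c : ℤ) :
    cs.projElem u (Finsupp.single w c) = Finsupp.single (cs.downWord (cs.reducedWord u) w) c :=
  cs.prod_projEnd_single _ _ _

theorem downWord_reducedWord_self (u : W) : cs.downWord (cs.reducedWord u) u = 1 := by
  have := cs.downWord_mul_wordProd (ω := cs.reducedWord u) (v := 1)
    (by simp [wordProd_reducedWord, length_reducedWord])
  rwa [one_mul, wordProd_reducedWord] at this

/-- Reaching `1` costs `ℓ(w)` descents and only `ℓ(u)` letters are available, so every letter is a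
genuine descent. -/
theorem eq_of_downWord_reducedWord_eq_one {u w : W} (h : cs.downWord (cs.reducedWord u) w = 1)
    (hl : cs.length u ≤ cs.length w) : w = u := by
  have h1 := cs.length_le_length_downWord (cs.reducedWord u) w
  have h2 := cs.eq_mul_wordProd_of_length_downWord (ω := cs.reducedWord u) (w := w)
  rw [h, length_one, length_reducedWord] at h1 h2
  rw [h2 (by omega), one_mul, wordProd_reducedWord]

theorem linearIndependent_projElem : LinearIndependent ℤ cs.projElem := by
  rw [linearIndependent_iff]
  intro c hc
  by_contra hne
  -- At the basis vector `u`, only the `P^u` term of the relation contributes to the coefficient of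
  -- `1`.
  obtain ⟨u, hu, hmax⟩ := Finset.exists_max_image c.support cs.length
    (Finsupp.support_nonempty_iff.2 hne)
  have h := DFunLike.congr_fun (LinearMap.congr_fun hc (Finsupp.single u 1)) 1
  rw [Finsupp.linearCombination_apply, Finsupp.sum, LinearMap.sum_apply, Finsupp.finsetSum_apply,
    Finset.sum_eq_single u] at h
  · rw [LinearMap.smul_apply, projElem_single, downWord_reducedWord_self] at h
    simp at h
    exact (Finsupp.mem_support_iff.1 hu) h
  · intro v hv hvu
    rw [LinearMap.smul_apply, projElem_single, Finsupp.smul_apply,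
      Finsupp.single_eq_of_ne, smul_zero]
    exact fun h1 => hvu (cs.eq_of_downWord_reducedWord_eq_one h1.symm (hmax v hv)).symm
  · exact fun h => absurd hu h

/-! ### The Coxeter monoid algebra -/

/-- The representation of the Coxeter monoid on `ℤW` by the `P^{s}`. -/
def monoidRep : M.CoxeterMonoid →* Module.End ℤ (W →₀ ℤ) :=
  monoidLift cs.isBraided_projEnd cs.projEnd_mul_self

theorem monoidRep_toMonoid (u : W) : cs.monoidRep (cs.toMonoid u) = cs.projElem u := by
  refine (cs.map_reducedProd (f := M.monoidGen) cs.monoidRep u).trans ?_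
  simp only [monoidRep, monoidLift_monoidGen]
  rfl

theorem toMonoid_bijective : Function.Bijective cs.toMonoid := by
  refine ⟨fun u v h => cs.linearIndependent_projElem.injective ?_, cs.toMonoid_surjective⟩
  rw [← monoidRep_toMonoid, h, monoidRep_toMonoid]

theorem linearIndependent_monoidRep : LinearIndependent ℤ cs.monoidRep := by
  rw [← linearIndependent_equiv (Equiv.ofBijective _ cs.toMonoid_bijective)]
  convert! cs.linearIndependent_projElem using 1
  exact funext cs.monoidRep_toMonoid

theorem lift_monoidRep_injective :
    Function.Injective (MonoidAlgebra.lift ℤ (Module.End ℤ (W →₀ ℤ)) M.CoxeterMonoid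
      cs.monoidRep) := by
  rw [injective_iff_map_eq_zero]
  intro x hx
  rw [MonoidAlgebra.lift_apply] at hx
  have := (linearIndependent_iff.1 cs.linearIndependent_monoidRep) x.coeff hx
  ext m
  exact DFunLike.congr_fun this m

theorem range_lift_monoidRep :
    (MonoidAlgebra.lift ℤ (Module.End ℤ (W →₀ ℤ)) M.CoxeterMonoid cs.monoidRep).range =
      cs.projAlgebra := by
  apply le_antisymm
  · rintro _ ⟨x, rfl⟩
    change MonoidAlgebra.lift ℤ _ _ cs.monoidRep x ∈ _
    rw [MonoidAlgebra.lift_apply]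
    refine Subalgebra.sum_mem _ fun m _ => Subalgebra.smul_mem _ ?_ _
    obtain ⟨u, rfl⟩ := cs.toMonoid_surjective m
    rw [monoidRep_toMonoid]
    refine Subalgebra.list_prod_mem _ fun y hy => ?_
    obtain ⟨s, -, rfl⟩ := List.mem_map.1 hy
    exact Algebra.subset_adjoin ⟨s, rfl⟩
  · refine Algebra.adjoin_le ?_
    rintro _ ⟨s, rfl⟩
    refine ⟨MonoidAlgebra.of ℤ _ (M.monoidGen s), ?_⟩
    change MonoidAlgebra.lift ℤ _ _ cs.monoidRep (MonoidAlgebra.of ℤ _ _) = _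
    rw [MonoidAlgebra.lift_of]
    exact monoidLift_monoidGen _ _ s

/-- The isomorphism from the monoid algebra of the Coxeter monoid onto the algebra generated by
the `P^{s}`. -/
def monoidAlgebraEquiv : MonoidAlgebra ℤ M.CoxeterMonoid ≃ₐ[ℤ] cs.projAlgebra :=
  (AlgEquiv.ofInjective _ cs.lift_monoidRep_injective).trans
    (Subalgebra.equivOfEq _ _ cs.range_lift_monoidRep)

theorem monoidAlgebraEquiv_of_toMonoid (u : W) :
    (cs.monoidAlgebraEquiv (MonoidAlgebra.of ℤ M.CoxeterMonoid (cs.toMonoid u)) :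
      Module.End ℤ (W →₀ ℤ)) = cs.projElem u := by
  change MonoidAlgebra.lift ℤ _ _ cs.monoidRep (MonoidAlgebra.of ℤ _ _) = _
  rw [MonoidAlgebra.lift_of, monoidRep_toMonoid]

/-! ### The `0`-Hecke algebra -/

theorem neg_projEnd_mul_self (s : B) :
    -cs.projEnd {s} * -cs.projEnd {s} = -(-cs.projEnd {s}) := by
  rw [neg_mul_neg, neg_neg, projEnd_mul_self]

/-- The representation `T_s ↦ -P^{s}` of the `0`-Hecke algebra on `ℤW`. -/
def zeroHeckeRep : M.ZeroHeckeAlgebra →ₐ[ℤ] Module.End ℤ (W →₀ ℤ) :=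
  zeroHeckeLift cs.isBraided_projEnd.neg cs.neg_projEnd_mul_self

theorem zeroHeckeRep_zeroHeckeGen (s : B) :
    cs.zeroHeckeRep (M.zeroHeckeGen s) = -cs.projEnd {s} :=
  zeroHeckeLift_zeroHeckeGen _ _ s

theorem zeroHeckeRep_reducedProd (u : W) :
    cs.zeroHeckeRep (cs.reducedProd M.zeroHeckeGen u) =
      (-1 : ℤ) ^ cs.length u • cs.projElem u := by
  rw [map_reducedProd]
  simp only [zeroHeckeRep_zeroHeckeGen]
  rw [reducedProd, prod_map_neg_eq_smul, length_reducedWord, projElem]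

theorem range_zeroHeckeRep : cs.zeroHeckeRep.range = cs.projAlgebra := by
  rw [zeroHeckeRep, range_zeroHeckeLift]
  apply le_antisymm <;> refine Algebra.adjoin_le ?_ <;> rintro _ ⟨s, rfl⟩
  · exact neg_mem (Algebra.subset_adjoin ⟨s, rfl⟩)
  · exact neg_mem_iff.1 (Algebra.subset_adjoin ⟨s, rfl⟩)

theorem reducedProd_zeroHeckeGen_mul_of_isRightDescent {w : W} {s : B}
    (h : cs.IsRightDescent w s) :
    cs.reducedProd M.zeroHeckeGen w * M.zeroHeckeGen s = -cs.reducedProd M.zeroHeckeGen w := by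
  rw [cs.reducedProd_of_isRightDescent isBraided_zeroHeckeGen h, mul_assoc, zeroHeckeGen_mul_self]
  exact mul_neg (α := M.ZeroHeckeAlgebra) _ _

theorem linearIndependent_zeroHeckeRep_reducedProd :
    LinearIndependent ℤ fun u => cs.zeroHeckeRep (cs.reducedProd M.zeroHeckeGen u) := by
  simp only [zeroHeckeRep_reducedProd]
  -- The signs are units of `ℤ`, so rescaling keeps independence.
  exact cs.linearIndependent_projElem.units_smul fun u => (-1 : ℤˣ) ^ cs.length u

/-- The two product rules make the span stable under right multiplication by generators, hence by
the whole algebra, and it contains `1`. -/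
theorem span_reducedProd_zeroHeckeGen :
    Submodule.span ℤ (Set.range (cs.reducedProd M.zeroHeckeGen)) = ⊤ := by
  set S := Submodule.span ℤ (Set.range (cs.reducedProd M.zeroHeckeGen)) with hS
  have hgen (s : B) : ∀ x ∈ S, x * M.zeroHeckeGen s ∈ S := by
    intro x hx
    induction hx using Submodule.span_induction with
    | mem x hx =>
      obtain ⟨w, rfl⟩ := hx
      by_cases h : cs.IsRightDescent w s
      · rw [cs.reducedProd_zeroHeckeGen_mul_of_isRightDescent h]
        exact neg_mem (Submodule.subset_span ⟨w, rfl⟩)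
      · rw [cs.reducedProd_mul_of_not_isRightDescent isBraided_zeroHeckeGen h]
        exact Submodule.subset_span ⟨_, rfl⟩
    | zero => simp
    | add x y _ _ hx hy => rw [add_mul]; exact add_mem hx hy
    | smul c x _ hx => rw [smul_mul_assoc]; exact Submodule.smul_mem _ c hx
  have hmul (a : FreeAlgebra ℤ B) :
      ∀ x ∈ S, x * RingQuot.mkAlgHom ℤ (M.HeckeRel (0 : ℤ)) a ∈ S := by
    induction a using FreeAlgebra.induction with
    | grade0 c =>
      intro x hx
      rw [AlgHom.commutes, ← Algebra.commutes, ← Algebra.smul_def]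
      exact Submodule.smul_mem _ c hx
    | grade1 s => exact hgen s
    | mul a b ha hb =>
      intro x hx
      rw [map_mul, ← mul_assoc]
      exact hb _ (ha x hx)
    | add a b ha hb =>
      intro x hx
      rw [map_add, mul_add]
      exact add_mem (ha x hx) (hb x hx)
  rw [eq_top_iff]
  intro y _
  obtain ⟨a, rfl⟩ := RingQuot.mkAlgHom_surjective ℤ _ y
  have h1 : (1 : M.ZeroHeckeAlgebra) ∈ S :=
    Submodule.subset_span ⟨1, cs.reducedProd_one isBraided_zeroHeckeGen⟩
  simpa using hmul a 1 h1

/-- The basis `T_w` of the `0`-Hecke algebra. -/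
def zeroHeckeBasis : Module.Basis W ℤ M.ZeroHeckeAlgebra :=
  Module.Basis.mk (cs.linearIndependent_zeroHeckeRep_reducedProd.of_comp
    cs.zeroHeckeRep.toLinearMap) cs.span_reducedProd_zeroHeckeGen.ge

theorem zeroHeckeBasis_apply (w : W) : cs.zeroHeckeBasis w = cs.reducedProd M.zeroHeckeGen w :=
  Module.Basis.mk_apply _ _ w

theorem zeroHeckeBasis_simple (s : B) : cs.zeroHeckeBasis (cs.simple s) = M.zeroHeckeGen s := by
  rw [zeroHeckeBasis_apply, cs.reducedProd_simple isBraided_zeroHeckeGen]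

theorem zeroHeckeRep_injective : Function.Injective cs.zeroHeckeRep := by
  rw [injective_iff_map_eq_zero]
  intro x hx
  have h : Finsupp.linearCombination ℤ
      (fun u => cs.zeroHeckeRep (cs.reducedProd M.zeroHeckeGen u)) (cs.zeroHeckeBasis.repr x) =
      0 := by
    rw [← hx]
    conv_rhs => rw [← cs.zeroHeckeBasis.linearCombination_repr x]
    simp only [Finsupp.linearCombination_apply, Finsupp.sum, map_sum, map_zsmul,
      zeroHeckeBasis_apply]
  exact (map_eq_zero_iff _ cs.zeroHeckeBasis.repr.injective).1
    (linearIndependent_iff.1 cs.linearIndependent_zeroHeckeRep_reducedProd _ h)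

end CoxeterSystem

end

theorem theorem3p4 {B W : Type*} [Group W] {M : CoxeterMatrix B} (cs : CoxeterSystem M W) :
    -- `P^u` does not depend on the reduced word of `u`
    (∀ ω : List B, cs.IsReduced ω →
      cs.projElem (cs.wordProd ω) = (ω.map fun s => cs.projEnd {s}).prod) ∧
    -- as sets, `W` is the Coxeter monoid, via products along reduced words
    ((∀ ω : List B, cs.IsReduced ω → cs.toMonoid (cs.wordProd ω) = (ω.map M.monoidGen).prod) ∧
      Function.Bijective cs.toMonoid) ∧
    -- `u ↦ P^u` is an isomorphism of `ℤ`-algebras from the monoid algebra onto the algebra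
    -- generated by the `P^{s}`
    (∃ Φ : MonoidAlgebra ℤ M.CoxeterMonoid ≃ₐ[ℤ] cs.projAlgebra,
      ∀ u : W, (Φ (MonoidAlgebra.of ℤ M.CoxeterMonoid (cs.toMonoid u)) :
        Module.End ℤ (W →₀ ℤ)) = cs.projElem u) ∧
    -- the `0`-Hecke algebra has a basis `T_w` with the usual product, and `T_s ↦ -P^{s}` is a
    -- faithful representation of it on `ℤW`
    (∃ (T : Module.Basis W ℤ M.ZeroHeckeAlgebra)
        (ρ : M.ZeroHeckeAlgebra →ₐ[ℤ] Module.End ℤ (W →₀ ℤ)),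
      T 1 = 1 ∧
      (∀ s : B, T (cs.simple s) = M.zeroHeckeGen s) ∧
      (∀ (w : W) (s : B), ¬ cs.IsRightDescent w s →
        T w * T (cs.simple s) = T (w * cs.simple s)) ∧
      (∀ (w : W) (s : B), cs.IsRightDescent w s → T w * T (cs.simple s) = -T w) ∧
      (∀ s : B, ρ (T (cs.simple s)) = -cs.projEnd {s}) ∧
      (∀ w : W, ρ (T w) = (-1 : ℤ) ^ cs.length w • cs.projElem w) ∧
      Function.Injective ρ ∧
      ρ.range = cs.projAlgebra) := by
  open CoxeterMatrix in
  -- `projElem` and `toMonoid` are `reducedProd` of the respective generators by definition.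
  refine ⟨fun ω hω => cs.reducedProd_wordProd cs.isBraided_projEnd hω,
    ⟨fun ω hω => cs.reducedProd_wordProd isBraided_monoidGen hω, cs.toMonoid_bijective⟩,
    ⟨cs.monoidAlgebraEquiv, cs.monoidAlgebraEquiv_of_toMonoid⟩,
    cs.zeroHeckeBasis, cs.zeroHeckeRep, ?_, cs.zeroHeckeBasis_simple, fun w s h => ?_,
    fun w s h => ?_, fun s => ?_, fun w => ?_, cs.zeroHeckeRep_injective, cs.range_zeroHeckeRep⟩
  · rw [cs.zeroHeckeBasis_apply, cs.reducedProd_one isBraided_zeroHeckeGen]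
  · rw [cs.zeroHeckeBasis_simple, cs.zeroHeckeBasis_apply, cs.zeroHeckeBasis_apply,
      cs.reducedProd_mul_of_not_isRightDescent isBraided_zeroHeckeGen h]
  · rw [cs.zeroHeckeBasis_simple, cs.zeroHeckeBasis_apply,
      cs.reducedProd_zeroHeckeGen_mul_of_isRightDescent h]
  · rw [cs.zeroHeckeBasis_simple, cs.zeroHeckeRep_zeroHeckeGen]
  · rw [cs.zeroHeckeBasis_apply, cs.zeroHeckeRep_reducedProd]
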